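/- Let $M$ be a complete, connected (smooth, finite-dimensional, boundaryless) Riemannian manifold, let $I(M)$ be its full isometry group, i.e. the group of all bijections of $M$ preserving the Riemannian distance, with the compact-open topology, and let $G\subset I(M)$ be any subgroup (not assumed closed), with the subspace topology. Then $G$ acts properly on $M$, i.e. the map $G\times M\to M\times M$, $(g,p)\mapsto (g(p),p)$, is proper, if and only if $G$ is closed in $I(M)$. -/

import Mathlib

open scoped Manifold ContDiff Bundle

noncomputable section

/-- The full isometry group `I(M) = M ≃ᵢ M` carries the compact-open topology, that is, the
topology induced from `C(M, M)`. -/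
instance IsometryEquiv.instTopologicalSpace {M : Type*} [PseudoEMetricSpace M] :
    TopologicalSpace (M ≃ᵢ M) :=
  TopologicalSpace.induced (fun g : M ≃ᵢ M => (⟨g, g.continuous⟩ : C(M, M))) inferInstance

/-- The tautological action of the isometry group `I(M)` on `M`, `g • p = g p`. Every subgroup
of `I(M)` inherits it. -/
instance IsometryEquiv.instMulAction {M : Type*} [PseudoEMetricSpace M] :
    MulAction (M ≃ᵢ M) M where
  smul g p := g p
  one_smul _ := rfl
  mul_smul _ _ _ := rfl

end

open Filter Topology

namespace IsometryEquiv

section Pseudo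

variable {X : Type*} [PseudoEMetricSpace X]

/-! Isometries are equicontinuous, so pointwise convergence is convergence in `I(M)`. If isometries
converge at one point along an ultrafilter, their set of convergence is open by local compactness
and closed by completeness, hence all of `M`; the inverses converge too, so the limit is an
isometry. Closedness puts it in `G`, which is properness in ultrafilter form. Conversely, properness
over `(f x, x)` forces a limit `f` of elements of `G` into `G`. -/

/-- A family of isometries that converges pointwise converges in the compact-open topology. -/
theorem tendsto_nhds_of_forall_tendsto {ι : Type*} {l : Filter ι} {g : ι → X ≃ᵢ X} {f : X ≃ᵢ X}
    (h : ∀ x, Tendsto (fun i => g i x) l (𝓝 (f x))) : Tendsto g l (𝓝 f) := by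
  rw [nhds_induced, tendsto_comap_iff]
  refine ContinuousMap.tendsto_of_tendstoLocallyUniformly ?_
  rw [EMetric.tendstoLocallyUniformly_iff]
  intro ε hε x
  have hε3 : 0 < ε / 3 := ENNReal.div_pos hε.ne' (by simp)
  refine ⟨Metric.eball x (ε / 3), Metric.eball_mem_nhds x hε3, ?_⟩
  filter_upwards [EMetric.tendsto_nhds.1 (h x) (ε / 3) hε3] with i hi y hy
  calc edist (f y) (g i y)
      ≤ edist (f y) (f x) + edist (f x) (g i x) + edist (g i x) (g i y) := edist_triangle4 _ _ _ _
    _ = edist y x + edist (g i x) (f x) + edist y x := by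
        rw [f.edist_eq, (g i).edist_eq, edist_comm (f x), edist_comm x y]
    _ < ε / 3 + ε / 3 + ε / 3 := ENNReal.add_lt_add (ENNReal.add_lt_add hy hi) hy
    _ = ε := ENNReal.add_thirds ε

theorem continuous_smul_pair [LocallyCompactSpace X] :
    Continuous fun q : (X ≃ᵢ X) × X => q.1 q.2 := by
  have h : Continuous fun g : X ≃ᵢ X => (⟨g, g.continuous⟩ : C(X, X)) := continuous_induced_dom
  exact (continuous_eval (F := C(X, X))).comp (h.prodMap continuous_id)

theorem continuous_eval_const (x : X) : Continuous fun g : X ≃ᵢ X => g x := by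
  have h : Continuous fun g : X ≃ᵢ X => (⟨g, g.continuous⟩ : C(X, X)) := continuous_induced_dom
  exact (ContinuousEvalConst.continuous_eval_const (F := C(X, X)) x).comp h

theorem tendsto_symm_apply {ι : Type*} {l : Filter ι} {g : ι → X ≃ᵢ X} {x y : X}
    (h : Tendsto (fun i => g i x) l (𝓝 y)) : Tendsto (fun i => (g i).symm y) l (𝓝 x) := by
  rw [tendsto_iff_edist_tendsto_0] at h ⊢
  refine h.congr fun i => ?_
  rw [← (g i).edist_eq ((g i).symm y), apply_symm_apply, edist_comm]

/-- Images of points near `x` eventually stay in a compact neighbourhood of `y`, where every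
ultrafilter converges. -/
theorem isOpen_setOf_exists_tendsto [LocallyCompactSpace X] {ι : Type*} (l : Ultrafilter ι)
    (g : ι → X ≃ᵢ X) : IsOpen {x | ∃ y, Tendsto (fun i => g i x) l (𝓝 y)} := by
  rw [EMetric.isOpen_iff]
  rintro x ⟨y, hy⟩
  obtain ⟨K, hK, hKy⟩ := exists_compact_mem_nhds y
  obtain ⟨ε, hε, hεK⟩ := EMetric.mem_nhds_iff.1 hKy
  have hε2 : 0 < ε / 2 := ENNReal.half_pos hε.ne'
  refine ⟨ε / 2, hε2, fun z hz => ?_⟩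
  have hmem : ∀ᶠ i in (l : Filter ι), g i z ∈ K := by
    filter_upwards [EMetric.tendsto_nhds.1 hy (ε / 2) hε2] with i hi
    refine hεK ?_
    calc edist (g i z) y ≤ edist (g i z) (g i x) + edist (g i x) y := edist_triangle _ _ _
      _ < ε / 2 + ε / 2 := ENNReal.add_lt_add (by rwa [(g i).edist_eq]) hi
      _ = ε := ENNReal.add_halves ε
  obtain ⟨w, -, hw⟩ := hK.ultrafilter_le_nhds (l.map fun i => g i z)
    (le_principal_iff.2 (Ultrafilter.mem_map.2 hmem))
  exact ⟨w, hw⟩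

/-- The images of `x` stay uniformly close to those of a nearby point of convergence, hence are
Cauchy. -/
theorem isClosed_setOf_exists_tendsto [CompleteSpace X] {ι : Type*} (l : Filter ι) [l.NeBot]
    (g : ι → X ≃ᵢ X) : IsClosed {x | ∃ y, Tendsto (fun i => g i x) l (𝓝 y)} := by
  rw [← closure_subset_iff_isClosed]
  intro x hx
  refine cauchy_map_iff_exists_tendsto.1 (EMetric.cauchy_iff.2 ⟨NeBot.ne inferInstance, fun ε hε => ?_⟩)
  have hε4 : 0 < ε / 2 / 2 := ENNReal.half_pos (ENNReal.half_pos hε.ne').ne'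
  obtain ⟨z, ⟨y, hy⟩, hxz⟩ := EMetric.mem_closure_iff.1 hx _ hε4
  refine ⟨Metric.eball y (ε / 2), mem_map.2 ?_, fun a ha b hb => ?_⟩
  · filter_upwards [EMetric.tendsto_nhds.1 hy _ hε4] with i hi
    calc edist (g i x) y ≤ edist (g i x) (g i z) + edist (g i z) y := edist_triangle _ _ _
      _ < ε / 2 / 2 + ε / 2 / 2 := ENNReal.add_lt_add (by rwa [(g i).edist_eq]) hi
      _ = ε / 2 := ENNReal.add_halves _
  · calc edist a b ≤ edist a y + edist b y := edist_triangle_right _ _ _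
      _ < ε / 2 + ε / 2 := ENNReal.add_lt_add ha hb
      _ = ε := ENNReal.add_halves ε

/-- On a connected, locally compact, complete space, isometries that converge at one point along
an ultrafilter converge at every point. -/
theorem exists_tendsto_apply [LocallyCompactSpace X] [CompleteSpace X] [PreconnectedSpace X]
    {ι : Type*} (l : Ultrafilter ι) (g : ι → X ≃ᵢ X) {x y : X}
    (h : Tendsto (fun i => g i x) l (𝓝 y)) (z : X) :
    ∃ w, Tendsto (fun i => g i z) l (𝓝 w) := by
  have hclopen : IsClopen {x | ∃ y, Tendsto (fun i => g i x) l (𝓝 y)} :=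
    ⟨isClosed_setOf_exists_tendsto _ g, isOpen_setOf_exists_tendsto l g⟩
  exact Set.eq_univ_iff_forall.1 (hclopen.eq_univ ⟨x, y, h⟩) z

end Pseudo

variable {X : Type*} [EMetricSpace X]

instance instT2Space : T2Space (X ≃ᵢ X) :=
  T2Space.of_injective_continuous
    (f := fun g : X ≃ᵢ X => (⟨g, g.continuous⟩ : C(X, X)))
    (fun _ _ h => IsometryEquiv.ext fun x => DFunLike.congr_fun h x) continuous_induced_dom

/-- On a connected, locally compact, complete space, isometries that converge at one point along
an ultrafilter converge in the isometry group. -/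
theorem exists_tendsto_nhds [LocallyCompactSpace X] [CompleteSpace X] [PreconnectedSpace X]
    {ι : Type*} (l : Ultrafilter ι) (g : ι → X ≃ᵢ X) {x y : X}
    (h : Tendsto (fun i => g i x) l (𝓝 y)) : ∃ f : X ≃ᵢ X, Tendsto g l (𝓝 f) := by
  choose f hf using exists_tendsto_apply l g h
  -- The limit of the inverses supplies the inverse of `f`, hence surjectivity.
  choose f' hf' using exists_tendsto_apply l (fun i => (g i).symm) (tendsto_symm_apply h)
  have hisom : Isometry f := fun a b =>
    tendsto_nhds_unique ((hf a).edist (hf b)) (by simp only [(g _).isometry.edist_eq, tendsto_const_nhds])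
  have hright : ∀ b, f (f' b) = b := fun b =>
    tendsto_nhds_unique (hf (f' b)) (tendsto_symm_apply (hf' b))
  exact ⟨IsometryEquiv.mk' f f' hright hisom, tendsto_nhds_of_forall_tendsto hf⟩

theorem isClosed_of_properSMul [Nonempty X] (G : Subgroup (X ≃ᵢ X)) [ProperSMul G X] :
    IsClosed (G : Set (X ≃ᵢ X)) := by
  rw [isClosed_iff_ultrafilter]
  intro f u huf huG
  obtain ⟨x⟩ := ‹Nonempty X›
  have hrange : Set.range (Subtype.val : G → X ≃ᵢ X) ∈ u := by
    rw [Subtype.range_coe_subtype]; exact huG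
  let v : Ultrafilter G := u.comap Subtype.val_injective hrange
  have hv : Tendsto (Subtype.val : G → X ≃ᵢ X) v (𝓝 f) :=
    (tendsto_comap (f := (Subtype.val : G → X ≃ᵢ X))).mono_right huf
  have hpair : Tendsto (fun q : G × X => (q.1 • q.2, q.2)) (v.map fun g => (g, x))
      (𝓝 (f x, x)) := by
    rw [Ultrafilter.coe_map, tendsto_map'_iff]
    exact (((continuous_eval_const x).tendsto f).comp hv).prodMk_nhds tendsto_const_nhds
  obtain ⟨⟨g, z⟩, -, hgz⟩ :=
    (isProperMap_iff_ultrafilter.1 (ProperSMul.isProperMap_smul_pair (G := G) (X := X))).2 hpair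
  -- The cluster point given by properness is a limit inside `G`; uniqueness of limits identifies it
  -- with `f`.
  have hvg : Tendsto (Subtype.val : G → X ≃ᵢ X) v (𝓝 (g : X ≃ᵢ X)) :=
    ((continuous_subtype_val.comp continuous_fst).tendsto (g, z)).comp
      (show Tendsto (fun g' : G => (g', x)) v (𝓝 (g, z)) from hgz)
  exact tendsto_nhds_unique hv hvg ▸ g.2

theorem properSMul_of_isClosed [LocallyCompactSpace X] [CompleteSpace X] [PreconnectedSpace X]
    (G : Subgroup (X ≃ᵢ X)) (hG : IsClosed (G : Set (X ≃ᵢ X))) : ProperSMul G X := by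
  refine ⟨isProperMap_iff_ultrafilter.2 ⟨?_, ?_⟩⟩
  · exact (continuous_smul_pair.comp (continuous_subtype_val.prodMap continuous_id)).prodMk
      continuous_snd
  rintro u ⟨y, p⟩ hu
  have hy : Tendsto (fun q : G × X => (q.1 : X ≃ᵢ X) q.2) u (𝓝 y) :=
    (continuous_fst.tendsto (y, p)).comp hu
  have hp : Tendsto (fun q : G × X => q.2) u (𝓝 p) := (continuous_snd.tendsto (y, p)).comp hu
  -- The moving point `q.2` can be frozen at its limit `p`, since isometries preserve the error
  -- `edist q.2 p`.
  have hyp : Tendsto (fun q : G × X => (q.1 : X ≃ᵢ X) p) u (𝓝 y) := by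
    rw [tendsto_iff_edist_tendsto_0] at hy hp ⊢
    refine tendsto_of_tendsto_of_tendsto_of_le_of_le tendsto_const_nhds
      (by simpa using hp.add hy) (fun _ => zero_le) fun q => ?_
    calc edist ((q.1 : X ≃ᵢ X) p) y
        ≤ edist ((q.1 : X ≃ᵢ X) p) ((q.1 : X ≃ᵢ X) q.2) + edist ((q.1 : X ≃ᵢ X) q.2) y :=
          edist_triangle _ _ _
      _ = edist q.2 p + edist ((q.1 : X ≃ᵢ X) q.2) y := by
          rw [(q.1 : X ≃ᵢ X).edist_eq, edist_comm p]
  obtain ⟨f, hf⟩ := exists_tendsto_nhds u (fun q : G × X => (q.1 : X ≃ᵢ X)) hyp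
  have hfG : f ∈ G := hG.mem_of_tendsto hf (Eventually.of_forall fun q => q.1.2)
  refine ⟨(⟨f, hfG⟩, p), Prod.ext ?_ rfl, ?_⟩
  · exact tendsto_nhds_unique (((continuous_eval_const p).tendsto f).comp hf) hyp
  · exact (tendsto_subtype_rng.2 hf).prodMk_nhds hp

end IsometryEquiv

theorem theorem2 {n : ℕ} {M : Type*} [EMetricSpace M]
    [ChartedSpace (EuclideanSpace ℝ (Fin n)) M] [IsManifold (𝓡 n) ∞ M]
    [Bundle.RiemannianBundle (fun x : M => TangentSpace (𝓡 n) x)]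
    [IsContMDiffRiemannianBundle (𝓡 n) ∞ (EuclideanSpace ℝ (Fin n))
      (fun x : M => TangentSpace (𝓡 n) x)]
    [IsRiemannianManifold (𝓡 n) M] [ConnectedSpace M] [CompleteSpace M]
    (G : Subgroup (M ≃ᵢ M)) :
    ProperSMul G M ↔ IsClosed (G : Set (M ≃ᵢ M)) := by
  have : LocallyCompactSpace M := ChartedSpace.locallyCompactSpace (EuclideanSpace ℝ (Fin n)) M
  exact ⟨fun _ => IsometryEquiv.isClosed_of_properSMul G,
    IsometryEquiv.properSMul_of_isClosed G⟩
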